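/- Let $n\ge 1$, $\lambda_p>0$, $\lambda_d\ge 0$, $r_d\ge 0$. Let $\Phi$ be a Matérn cluster process on $\mathbb{R}^n$: the parent points $X_1,X_2,\dots$ form a homogeneous Poisson point process on $\mathbb{R}^n$ of intensity $\lambda_p$; to the parent points one associates daughter point processes $\Phi_1,\Phi_2,\dots$, independent of each other and of the parents, each of them a Poisson point process with intensity function $\lambda_d\,\mathbf{1}(\|y\|\le r_d)$; and $\Phi=\bigcup_i (X_i+\Phi_i)$, where point processes are regarded as random counting measures (so the union is the sum of the counting measures). For $r\ge 0$ let $N$ be the number of points of $\Phi$ in the closed ball $\mathcal{B}(o,r)$ of radius $r$ about the origin. Let $v_n=\pi^{n/2}/\Gamma(\frac n2+1)$ be the volume of the unit ball of $\mathbb{R}^n$, and let $\mathcal{A}(r,r_d,x)$ be the volume of the intersection of $\mathcal{B}(o,r)$ with a ball of radius $r_d$ whose centre has norm $x$. Then $N$ is almost surely finite and, for every real $s$, the random variable $s^N$ (with $0^0=1$) is integrable and the probability generating function of $N$ is $$\mathbb{E}[s^N]=\exp(g(s)),\qquad g(s)=v_n\lambda_p\left(\int_0^{r+r_d} n\,e^{\lambda_d\mathcal{A}(r,r_d,x)(s-1)}\,x^{n-1}\,dx-(r+r_d)^n\right).$$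 -/

import Mathlib

open MeasureTheory ProbabilityTheory Metric
open scoped ENNReal NNReal

noncomputable section

namespace MaternCluster

/-- A locally finite counting measure: it is finite and integer valued on every bounded
Borel set. A point configuration is identified with the measure counting its points. -/
def IsPointConfiguration {E : Type*} [PseudoMetricSpace E] [MeasurableSpace E]
    (m : Measure E) : Prop :=
  ∀ B : Set E, MeasurableSet B → Bornology.IsBounded B → ∃ k : ℕ, m B = (k : ℝ≥0∞)

/-- `η` is a point process on `E` (a random locally finite counting measure on the
probability space `(Ω, P)`) which is Poisson with intensity measure `Λ`: the number of points
in a Borel set `B` with `Λ B < ∞` is Poisson distributed with mean `Λ B`, and the numbers of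
points in pairwise disjoint Borel sets are independent. -/
structure IsPoissonProcess {Ω E : Type*} [MeasurableSpace Ω] [PseudoMetricSpace E]
    [MeasurableSpace E] (P : Measure Ω) (Λ : Measure E) (η : Ω → Measure E) : Prop where
  measurable : Measurable η
  isPointConfiguration : ∀ᵐ ω ∂P, IsPointConfiguration (η ω)
  hasLaw : ∀ B : Set E, MeasurableSet B → Λ B < ∞ →
    HasLaw (fun ω => η ω B)
      ((poissonMeasure (Λ B).toNNReal).map (fun k : ℕ => (k : ℝ≥0∞))) P
  indep : ∀ (k : ℕ) (B : Fin k → Set E), (∀ i, MeasurableSet (B i)) →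
    Pairwise (fun i j => Disjoint (B i) (B j)) →
    iIndepFun (fun (i : Fin k) (ω : Ω) => η ω (B i)) P

/-- The superposition `⋃ᵢ (X i + D i)` of the clusters `D i` translated to the parent points
`X i`, as a counting measure. -/
def clusterUnion {E : Type*} [AddGroup E] [MeasurableSpace E]
    (X : ℕ → E) (D : ℕ → Measure E) : Measure E :=
  Measure.sum fun i => (D i).map (fun y => X i + y)

/-- `Φ` is a Matérn cluster process on `ℝⁿ`: the parent points `X i` form a homogeneous Poisson
process of intensity `lamP`; the daughter processes `D i` are independent Poisson processes of
intensity `lamD` on the ball `B(o, rd)`, independent of the parents; and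
`Φ = ⋃ᵢ (X i + D i)`. -/
def IsMaternClusterProcess {Ω : Type*} [MeasurableSpace Ω] {n : ℕ} (P : Measure Ω)
    (lamP lamD rd : ℝ) (Φ : Ω → Measure (EuclideanSpace ℝ (Fin n))) : Prop :=
  ∃ (X : ℕ → Ω → EuclideanSpace ℝ (Fin n)) (D : ℕ → Ω → Measure (EuclideanSpace ℝ (Fin n))),
    (∀ i, Measurable (X i)) ∧
    IsPoissonProcess P (ENNReal.ofReal lamP • volume)
      (fun ω => Measure.sum fun i => Measure.dirac (X i ω)) ∧
    (∀ i, IsPoissonProcess P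
      (ENNReal.ofReal lamD • volume.restrict (closedBall 0 rd)) (D i)) ∧
    iIndepFun D P ∧
    IndepFun (fun ω i => X i ω) (fun ω i => D i ω) P ∧
    ∀ᵐ ω ∂P, Φ ω = clusterUnion (fun i => X i ω) (fun i => D i ω)

/-- The number of points of the configuration `m` in `B`, as a natural number. It is only used
where `m B` is a natural number almost surely, and then it equals `m B`. -/
def pointCount {E : Type*} [MeasurableSpace E] (m : Measure E) (B : Set E) : ℕ :=
  ⌊(m B).toReal⌋₊

/-- The volume `v_n = π ^ (n / 2) / Γ(n / 2 + 1)` of the unit ball of `ℝⁿ`. -/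
def unitBallVolume (n : ℕ) : ℝ :=
  Real.pi ^ ((n : ℝ) / 2) / Real.Gamma ((n : ℝ) / 2 + 1)

/-- `𝒜(r, rd, x)`: the volume of the intersection of the balls `B(o, r)` and `B(c, rd)` of `ℝⁿ`,
where `c` is a point with `‖c‖ = x`; the point `c = (x, 0, …, 0)` is taken. -/
def interVolume (n : ℕ) [NeZero n] (r rd x : ℝ) : ℝ :=
  (volume : Measure (EuclideanSpace ℝ (Fin n))).real
    (closedBall 0 r ∩ closedBall (EuclideanSpace.single (0 : Fin n) x) rd)

/-- The choice of the second centre in `interVolume` does not matter. -/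
theorem interVolume_norm (n : ℕ) [NeZero n] (r rd : ℝ) (c : EuclideanSpace ℝ (Fin n)) :
    (volume : Measure (EuclideanSpace ℝ (Fin n))).real (closedBall 0 r ∩ closedBall c rd) =
      interVolume n r rd ‖c‖ := by
  set d : EuclideanSpace ℝ (Fin n) := EuclideanSpace.single (0 : Fin n) ‖c‖ with hd
  have hnorm : ‖d‖ = ‖c‖ := by simp [hd]
  set e := (ℝ ∙ (d - c))ᗮ.reflection with he
  have hdc : e d = c := Submodule.reflection_sub hnorm
  have hpre : e ⁻¹' (closedBall 0 r ∩ closedBall c rd) = closedBall 0 r ∩ closedBall d rd := by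
    rw [Set.preimage_inter, ← hdc, e.preimage_closedBall, e.preimage_closedBall]
    simp
  have hmp := e.measurePreserving
  rw [interVolume, ← hd, ← hpre, Measure.real, Measure.real,
    hmp.measure_preimage (measurableSet_closedBall.inter measurableSet_closedBall).nullMeasurableSet]

/-- The exponent `g(s)` of the probability generating function. -/
def exponent (n : ℕ) [NeZero n] (lamP lamD rd r s : ℝ) : ℝ :=
  unitBallVolume n * lamP *
    ((∫ x in (0 : ℝ)..(r + rd),
        (n : ℝ) * Real.exp (lamD * interVolume n r rd x * (s - 1)) * x ^ (n - 1)) -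
      (r + rd) ^ n)

end MaternCluster

end

/-! Only parents in the ball of radius `r + rd` can contribute to N, and almost surely there are
finitely many of them. Given the parents, the contributions of the clusters are independent Poisson
variables with means f(X i), where f(x) = `lamD` · 𝒜(r, rd, ‖x‖), so the conditional generating
function is exp((s - 1) ∑ f(X i)). Its expectation is an exponential functional of the parent
process η: E exp(∫ h dη) = exp(∫ (e^h - 1) dΛ) with h = (s - 1) f (`integral_exp_integral`). Polar
coordinates turn this exponent into g(s), the term -1 producing -(r + rd)^n
(`integral_exp_sub_one_eq_exponent`).

No conditional expectations are used. The identity is proved for the first m clusters by Fubini on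
the joint law of points and marks (`integral_prod_marks`, `integral_pow_sum_clusterCount`), and then
m → ∞ (`integral_pow_of_eventually_eq`). As s is an arbitrary real, this limit needs a dominating
function: Fatou's lemma gives integrability of a^N for a ≥ 1, and max(1, |s|)^N dominates. -/

namespace MaternCluster

/-! ### Generating function of the Poisson law. -/

section Poisson

theorem hasSum_poisson_mul_pow (c : ℝ≥0) (a : ℝ) :
    HasSum (fun k : ℕ => Real.exp (-c) * c ^ k / (k.factorial : ℝ) * a ^ k)
      (Real.exp (c * (a - 1))) := by
  have h := (NormedSpace.expSeries_div_hasSum_exp ((c : ℝ) * a)).mul_left (Real.exp (-c))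
  rw [← Real.exp_eq_exp_ℝ, ← Real.exp_add] at h
  convert! h using 1
  · ext k
    rw [mul_pow]
    ring
  · congr 1
    ring

theorem integrable_pow_poissonMeasure (c : ℝ≥0) (a : ℝ) :
    Integrable (fun k : ℕ => a ^ k) (poissonMeasure c) := by
  rw [integrable_poissonMeasure_iff]
  simpa [norm_pow] using (hasSum_poisson_mul_pow c |a|).summable

theorem integral_pow_poissonMeasure (c : ℝ≥0) (a : ℝ) :
    ∫ k : ℕ, a ^ k ∂(poissonMeasure c) = Real.exp (c * (a - 1)) := by
  rw [integral_poissonMeasure]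
  exact (hasSum_poisson_mul_pow c a).tsum_eq

end Poisson

/-! ### Counts and exponential functionals of a Poisson process. -/

namespace IsPoissonProcess

variable {Ω E : Type*} [MeasurableSpace Ω] [PseudoMetricSpace E] [MeasurableSpace E]
  {P : Measure Ω} {Λ : Measure E} {η : Ω → Measure E}

theorem measurable_apply (h : IsPoissonProcess P Λ η) {B : Set E} (hB : MeasurableSet B) :
    Measurable fun ω => η ω B :=
  (Measure.measurable_coe hB).comp h.measurable

theorem integrable_comp (h : IsPoissonProcess P Λ η) {B : Set E} (hB : MeasurableSet B)
    (hΛ : Λ B < ∞) {g : ℝ≥0∞ → ℝ} (hg : Measurable g)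
    (hi : Integrable (fun k : ℕ => g k) (poissonMeasure (Λ B).toNNReal)) :
    Integrable (fun ω => g (η ω B)) P ∧
      ∫ ω, g (η ω B) ∂P = ∫ k : ℕ, g k ∂(poissonMeasure (Λ B).toNNReal) := by
  have hl := h.hasLaw B hB hΛ
  have hm : AEMeasurable (fun k : ℕ => (k : ℝ≥0∞)) (poissonMeasure (Λ B).toNNReal) :=
    Measurable.of_discrete.aemeasurable
  constructor
  · have : Integrable g (P.map fun ω => η ω B) := by
      rw [hl.map_eq, integrable_map_measure hg.aestronglyMeasurable hm]
      exact hi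
    exact (integrable_map_measure hg.aestronglyMeasurable hl.aemeasurable).1 this
  · rw [← integral_map hl.aemeasurable hg.aestronglyMeasurable, hl.map_eq,
      integral_map hm hg.aestronglyMeasurable]

theorem ae_exists_nat (h : IsPoissonProcess P Λ η) {B : Set E} (hB : MeasurableSet B)
    (hΛ : Λ B < ∞) : ∀ᵐ ω ∂P, ∃ k : ℕ, η ω B = k := by
  have hl := h.hasLaw B hB hΛ
  have hs : MeasurableSet {x : ℝ≥0∞ | ∃ k : ℕ, x = k} := by
    have : {x : ℝ≥0∞ | ∃ k : ℕ, x = k} = Set.range (fun k : ℕ => (k : ℝ≥0∞)) := by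
      ext x
      simp [eq_comm]
    rw [this]
    exact (Set.countable_range _).measurableSet
  have : ∀ᵐ x ∂(P.map fun ω => η ω B), ∃ k : ℕ, x = (k : ℝ≥0∞) := by
    rw [hl.map_eq, ae_map_iff (Measurable.of_discrete (f := fun k : ℕ => (k : ℝ≥0∞))).aemeasurable hs]
    exact Filter.Eventually.of_forall fun k => ⟨k, rfl⟩
  exact ae_of_ae_map hl.aemeasurable this

theorem integral_pow_count (h : IsPoissonProcess P Λ η) {B : Set E} (hB : MeasurableSet B)
    (hΛ : Λ B < ∞) (a : ℝ) :
    Integrable (fun ω => a ^ pointCount (η ω) B) P ∧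
      ∫ ω, a ^ pointCount (η ω) B ∂P = Real.exp (Λ.real B * (a - 1)) := by
  have hg : Measurable fun x : ℝ≥0∞ => a ^ ⌊x.toReal⌋₊ := by
    have : Measurable fun k : ℕ => a ^ k := Measurable.of_discrete
    exact this.comp (Nat.measurable_floor.comp ENNReal.measurable_toReal)
  have hi := integrable_pow_poissonMeasure (Λ B).toNNReal a
  obtain ⟨h1, h2⟩ := h.integrable_comp hB hΛ hg (by simpa using hi)
  refine ⟨h1, h2.trans ?_⟩
  simpa [measureReal_def, pointCount, ENNReal.coe_toNNReal_eq_toReal] using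
    integral_pow_poissonMeasure (Λ B).toNNReal a

theorem integral_exp_mul_count (h : IsPoissonProcess P Λ η) {B : Set E} (hB : MeasurableSet B)
    (hΛ : Λ B < ∞) (t : ℝ) :
    Integrable (fun ω => Real.exp (t * (η ω).real B)) P ∧
      ∫ ω, Real.exp (t * (η ω).real B) ∂P = Real.exp ((Real.exp t - 1) * Λ.real B) := by
  have hg : Measurable fun x : ℝ≥0∞ => Real.exp (t * x.toReal) := by fun_prop
  have he (k : ℕ) : Real.exp (t * k) = Real.exp t ^ k := by
    rw [mul_comm, Real.exp_nat_mul]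
  have hi := integrable_pow_poissonMeasure (Λ B).toNNReal (Real.exp t)
  obtain ⟨h1, h2⟩ := h.integrable_comp hB hΛ hg (by simpa [he] using hi)
  refine ⟨h1, h2.trans ?_⟩
  simpa [measureReal_def, he, mul_comm, ENNReal.coe_toNNReal_eq_toReal] using
    integral_pow_poissonMeasure (Λ B).toNNReal (Real.exp t)

theorem iIndepFun_fintype (h : IsPoissonProcess P Λ η) {ι : Type*} [Fintype ι] {B : ι → Set E}
    (hB : ∀ i, MeasurableSet (B i)) (hd : Pairwise fun i j => Disjoint (B i) (B j)) :
    iIndepFun (fun i ω => η ω (B i)) P := by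
  let e := Fintype.equivFin ι
  have := h.indep (Fintype.card ι) (fun i => B (e.symm i)) (fun i => hB _)
    fun i j hij => hd (e.symm.injective.ne hij)
  simpa using this.precomp e.injective

/-- The exponential functional of a Poisson process on simple functions. -/
theorem integral_exp_simpleFunc [IsProbabilityMeasure P] (h : IsPoissonProcess P Λ η)
    (f : SimpleFunc E ℝ) {W : Set E} (hW : MeasurableSet W) (hΛ : Λ W < ∞)
    (hf : ∀ x ∉ W, f x = 0) :
    ∫ ω, Real.exp (∫ x, f x ∂(η ω)) ∂P = Real.exp (∫ x, (Real.exp (f x) - 1) ∂Λ) := by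
  -- Nonzero levels lie in `W`, hence have finite intensity.
  have hsub (c : ℝ) (hc : c ≠ 0) : f ⁻¹' {c} ⊆ W := by
    intro x hx
    by_contra hxW
    exact hc (by rw [← (hx : f x = c), hf x hxW])
  have hint (μ : Measure E) (hμ : μ W < ∞) : Integrable f μ :=
    SimpleFunc.integrable_iff.2 fun c hc => (measure_mono (hsub c hc)).trans_lt hμ
  have hint' : Integrable (f.map fun c => Real.exp c - 1) Λ :=
    SimpleFunc.integrable_iff.2 fun c hc => by
      refine (measure_mono fun x hx => ?_).trans_lt hΛ
      by_contra hxW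
      apply hc
      rw [← (hx : (f.map fun c => Real.exp c - 1) x = c), SimpleFunc.map_apply, hf x hxW]
      simp
  -- The level sets of `f` partition the space, so the exponential factors over their counts, which
  -- are independent.
  have h1 : (fun ω => Real.exp (∫ x, f x ∂(η ω))) =ᵐ[P] fun ω =>
      ∏ c : f.range, Real.exp ((c : ℝ) * (η ω (f ⁻¹' {(c : ℝ)})).toReal) := by
    filter_upwards [h.ae_exists_nat hW hΛ] with ω hω
    obtain ⟨k, hk⟩ := hω
    have hlt : η ω W < ∞ := by rw [hk]; exact ENNReal.natCast_lt_top k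
    rw [← Real.exp_sum]
    congr 1
    rw [← SimpleFunc.integral_eq_integral f (hint _ hlt), SimpleFunc.integral_eq,
      Finset.sum_coe_sort f.range fun c => c * (η ω (f ⁻¹' {c})).toReal]
    exact Finset.sum_congr rfl fun c _ => by rw [smul_eq_mul, mul_comm]; rfl
  have h2 : ∫ x, (Real.exp (f x) - 1) ∂Λ =
      ∑ c : f.range, (Real.exp (c : ℝ) - 1) * Λ.real (f ⁻¹' {(c : ℝ)}) := by
    have := SimpleFunc.map_integral f (fun c => Real.exp c - 1) (hint Λ hΛ) (by simp)
    rw [SimpleFunc.integral_eq_integral _ hint'] at this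
    rw [Finset.sum_coe_sort f.range fun c => (Real.exp c - 1) * Λ.real (f ⁻¹' {c})]
    exact this.trans (Finset.sum_congr rfl fun c _ => by rw [smul_eq_mul, mul_comm])
  rw [integral_congr_ae h1, h2, Real.exp_sum]
  have hind := h.iIndepFun_fintype (ι := f.range) (B := fun c => f ⁻¹' {(c : ℝ)})
    (fun c => f.measurableSet_fiber _) fun c d hcd =>
      Disjoint.preimage f (Set.disjoint_singleton.2 (Subtype.coe_ne_coe.2 hcd))
  rw [hind.integral_fun_prod_comp (f := fun (c : f.range) (x : ℝ≥0∞) => Real.exp ((c : ℝ) * x.toReal))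
    (fun c => (h.measurable_apply (f.measurableSet_fiber _)).aemeasurable)
    (fun c => Measurable.aestronglyMeasurable (by fun_prop))]
  refine Finset.prod_congr rfl fun c _ => ?_
  -- The zero level may have infinite intensity, so its count need not be Poisson; its factor is 1
  -- on both sides.
  by_cases hc : (c : ℝ) = 0
  · simp [hc]
  · exact (h.integral_exp_mul_count (f.measurableSet_fiber _)
      ((measure_mono (hsub c hc)).trans_lt hΛ) c).2

/-- The exponential functional of a Poisson process. -/
theorem integral_exp_integral [IsProbabilityMeasure P] (h : IsPoissonProcess P Λ η)
    {f : E → ℝ} (hfm : Measurable f) {C : ℝ} (hC : ∀ x, |f x| ≤ C)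
    {W : Set E} (hW : MeasurableSet W) (hΛ : Λ W < ∞) (hf : ∀ x ∉ W, f x = 0) :
    Integrable (fun ω => Real.exp (∫ x, f x ∂(η ω))) P ∧
      ∫ ω, Real.exp (∫ x, f x ∂(η ω)) ∂P = Real.exp (∫ x, (Real.exp (f x) - 1) ∂Λ) := by
  rcases isEmpty_or_nonempty E with hE | ⟨⟨x₀⟩⟩
  · simp [integral_of_isEmpty]
  have hC0 : 0 ≤ C := (abs_nonneg _).trans (hC x₀)
  have hsm : StronglyMeasurable f := hfm.stronglyMeasurable
  -- Truncation at `C` and restriction to `W` give one bound, C · 1_W, for all approximants.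
  let g : ℕ → SimpleFunc E ℝ := fun k => (hsm.approxBounded C k).restrict W
  have hg (k : ℕ) (x : E) : g k x = W.indicator (hsm.approxBounded C k) x := by
    rw [SimpleFunc.restrict_apply _ hW]
  have hg0 (k : ℕ) (x : E) (hx : x ∉ W) : g k x = 0 := by
    rw [hg, Set.indicator_of_notMem hx]
  have hgC (k : ℕ) (x : E) : |g k x| ≤ W.indicator (fun _ => C) x := by
    rw [hg]
    by_cases hx : x ∈ W
    · simpa [hx] using hsm.norm_approxBounded_le hC0 k x
    · simp [hx]
  have hlim (x : E) : Filter.Tendsto (fun k => g k x) Filter.atTop (nhds (f x)) := by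
    by_cases hx : x ∈ W
    · simpa [hg, hx] using hsm.tendsto_approxBounded_of_norm_le (x := x) (hC x)
    · simp [hg, hx, hf x hx]
  have hbd (μ : Measure E) (hμ : μ W < ∞) : Integrable (W.indicator fun _ => C) μ :=
    (integrable_indicator_iff hW).2 (integrableOn_const hμ.ne)
  have hfin : ∀ᵐ ω ∂P, η ω W < ∞ := by
    filter_upwards [h.ae_exists_nat hW hΛ] with ω ⟨k, hk⟩
    rw [hk]
    exact ENNReal.natCast_lt_top k
  have hle (k : ℕ) (μ : Measure E) (hμ : μ W < ∞) : ∫ x, g k x ∂μ ≤ C * μ.real W := by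
    calc ∫ x, g k x ∂μ ≤ ∫ x, W.indicator (fun _ => C) x ∂μ :=
          integral_mono ((hbd μ hμ).mono' (g k).aestronglyMeasurable
            (Filter.Eventually.of_forall (hgC k))) (hbd μ hμ)
            fun x => (le_abs_self _).trans (hgC k x)
      _ = C * μ.real W := by rw [integral_indicator_const _ hW, smul_eq_mul, mul_comm]
  have hconv (μ : Measure E) (hμ : μ W < ∞) :
      Filter.Tendsto (fun k => ∫ x, g k x ∂μ) Filter.atTop (nhds (∫ x, f x ∂μ)) :=
    tendsto_integral_of_dominated_convergence _ (fun k => (g k).aestronglyMeasurable)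
      (hbd μ hμ) (fun k => Filter.Eventually.of_forall (hgC k)) (Filter.Eventually.of_forall hlim)
  -- For a simple function the integral is almost surely a finite combination of counts, which are
  -- measurable in ω.
  have hgm (k : ℕ) : AEStronglyMeasurable (fun ω => ∫ x, g k x ∂(η ω)) P := by
    have h1 : (fun ω => ∫ x, g k x ∂(η ω)) =ᵐ[P] fun ω =>
        ∑ c ∈ (g k).range, (η ω (g k ⁻¹' {c})).toReal * c := by
      filter_upwards [hfin] with ω hω
      rw [← SimpleFunc.integral_eq_integral _ ((hbd _ hω).mono' (g k).aestronglyMeasurable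
        (Filter.Eventually.of_forall (hgC k))), SimpleFunc.integral_eq]
      rfl
    refine AEStronglyMeasurable.congr (Measurable.aestronglyMeasurable ?_) h1.symm
    exact Finset.measurable_sum _ fun c _ =>
      (h.measurable_apply ((g k).measurableSet_fiber c)).ennreal_toReal.mul_const c
  -- The dominating function exp(C · η(W)) is an exponential moment of a Poisson variable.
  have hdom := (h.integral_exp_mul_count hW hΛ C).1
  have hgb (k : ℕ) : ∀ᵐ ω ∂P, ‖Real.exp (∫ x, g k x ∂(η ω))‖ ≤ Real.exp (C * (η ω).real W) := by
    filter_upwards [hfin] with ω hω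
    rw [Real.norm_eq_abs, Real.abs_exp]
    exact Real.exp_le_exp.2 (hle k _ hω)
  have hgl : ∀ᵐ ω ∂P, Filter.Tendsto (fun k => Real.exp (∫ x, g k x ∂(η ω))) Filter.atTop
      (nhds (Real.exp (∫ x, f x ∂(η ω)))) := by
    filter_upwards [hfin] with ω hω
    exact (Real.continuous_exp.tendsto _).comp (hconv _ hω)
  have hgm' (k : ℕ) : AEStronglyMeasurable (fun ω => Real.exp (∫ x, g k x ∂(η ω))) P :=
    Real.continuous_exp.comp_aestronglyMeasurable (hgm k)
  refine ⟨hdom.mono' (aestronglyMeasurable_of_tendsto_ae _ hgm' hgl) ?_, ?_⟩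
  · filter_upwards [hgl, ae_all_iff.2 hgb] with ω h1 h2
    exact le_of_tendsto h1.norm (Filter.Eventually.of_forall h2)
  · have h1 := tendsto_integral_of_dominated_convergence _ hgm' hdom hgb hgl
    refine tendsto_nhds_unique h1 ?_
    simp_rw [h.integral_exp_simpleFunc (g _) hW hΛ (hg0 _)]
    refine (Real.continuous_exp.tendsto _).comp ?_
    refine tendsto_integral_of_dominated_convergence (W.indicator fun _ => Real.exp C + 1)
      (fun k => ?_) ((integrable_indicator_iff hW).2 (integrableOn_const hΛ.ne))
      (fun k => Filter.Eventually.of_forall fun x => ?_) (Filter.Eventually.of_forall fun x => ?_)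
    · exact ((Real.measurable_exp.comp (g k).measurable).sub_const 1).aestronglyMeasurable
    · by_cases hx : x ∈ W
      · rw [Set.indicator_of_mem hx, Real.norm_eq_abs]
        have h3 := hgC k x
        rw [Set.indicator_of_mem hx] at h3
        refine (abs_sub _ _).trans ?_
        rw [Real.abs_exp, abs_one]
        gcongr
        exact (le_abs_self _).trans h3
      · simp [hg0 k x hx, hx]
    · exact ((Real.continuous_exp.tendsto _).comp (hlim x)).sub_const 1

end IsPoissonProcess
-- Independent marks attached to random points.
section Marking

variable {Ω E F : Type*} [MeasurableSpace Ω] [MeasurableSpace E] [MeasurableSpace F]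
  {P : Measure Ω} [IsProbabilityMeasure P] {X : ℕ → Ω → E} {D : ℕ → Ω → F}

/-- Integrating out independent marks, independent of the points, in a finite product. -/
theorem integral_prod_marks (hX : ∀ i, Measurable (X i)) (hD : ∀ i, Measurable (D i))
    (hDi : iIndepFun D P) (hXD : IndepFun (fun ω i => X i ω) (fun ω i => D i ω) P)
    {ψ : E → F → ℝ} (hψ : Measurable (Function.uncurry ψ))
    (hi : ∀ x i, Integrable (fun ω => ψ x (D i ω)) P) {u v : E → ℝ}
    (hu : ∀ x i, ∫ ω, ψ x (D i ω) ∂P = u x) (hv : ∀ x i, ∫ ω, |ψ x (D i ω)| ∂P = v x)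
    (hvm : Measurable v) {K : ℝ} (hK : ∀ x, v x ≤ K) (m : ℕ) :
    Integrable (fun ω => ∏ i ∈ Finset.range m, ψ (X i ω) (D i ω)) P ∧
      ∫ ω, ∏ i ∈ Finset.range m, ψ (X i ω) (D i ω) ∂P =
        ∫ ω, ∏ i ∈ Finset.range m, u (X i ω) ∂P := by
  let X' : Ω → Fin m → E := fun ω i => X i ω
  let D' : Ω → Fin m → F := fun ω i => D i ω
  have hX' : Measurable X' := measurable_pi_lambda _ fun i => hX i
  have hD' : Measurable D' := measurable_pi_lambda _ fun i => hD i
  have hXD' : IndepFun X' D' P :=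
    hXD.comp (φ := fun x (i : Fin m) => x i) (ψ := fun d (i : Fin m) => d i)
      (measurable_pi_lambda _ fun i => measurable_pi_apply _)
      (measurable_pi_lambda _ fun i => measurable_pi_apply _)
  have hlaw := (indepFun_iff_map_prod_eq_prod_map_map hX'.aemeasurable hD'.aemeasurable).1 hXD'
  have hDi' : iIndepFun (fun i : Fin m => D i) P := hDi.precomp Fin.val_injective
  have hpi : P.map D' = Measure.pi fun i : Fin m => P.map (D i) :=
    hDi'.map_fun_eq_pi_map fun i => (hD i).aemeasurable
  have hpr (i : ℕ) : IsProbabilityMeasure (P.map (D i)) :=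
    Measure.isProbabilityMeasure_map (hD i).aemeasurable
  have hprX : IsProbabilityMeasure (P.map X') :=
    Measure.isProbabilityMeasure_map hX'.aemeasurable
  let G : (Fin m → E) × (Fin m → F) → ℝ := fun p => ∏ i, ψ (p.1 i) (p.2 i)
  have hG : Measurable G := by
    refine Finset.measurable_prod _ fun i _ => ?_
    have h1 : Measurable fun p : (Fin m → E) × (Fin m → F) => (p.1 i, p.2 i) :=
      ((measurable_pi_apply i).comp measurable_fst).prodMk
        ((measurable_pi_apply i).comp measurable_snd)
    exact hψ.comp h1
  have hψx (x : E) : Measurable (ψ x) := hψ.comp measurable_prodMk_left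
  have hi' (x : E) (i : ℕ) : Integrable (ψ x) (P.map (D i)) :=
    (integrable_map_measure (hψx x).aestronglyMeasurable (hD i).aemeasurable).2 (hi x i)
  have hint : Integrable G ((P.map X').prod (P.map D')) := by
    rw [hpi, integrable_prod_iff hG.aestronglyMeasurable]
    refine ⟨Filter.Eventually.of_forall fun x => Integrable.fintype_prod fun i => hi' (x i) i, ?_⟩
    -- For fixed points the absolute product integrates over the marks to ∏ v(x i), which is at most
    -- K^m; Fubini therefore applies.
    have h1 (x : Fin m → E) :
        ∫ d, ‖G (x, d)‖ ∂(Measure.pi fun i : Fin m => P.map (D i)) = ∏ i, v (x i) := by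
      simp only [G, Real.norm_eq_abs, Finset.abs_prod]
      rw [integral_fintype_prod_eq_prod (f := fun (i : Fin m) d => |ψ (x i) d|)]
      refine Finset.prod_congr rfl fun i _ => ?_
      rw [integral_map (hD i).aemeasurable (hψx _).abs.aestronglyMeasurable, hv]
    have hv0 (x : E) : 0 ≤ v x := by
      rw [← hv x 0]
      exact integral_nonneg fun _ => abs_nonneg _
    simp_rw [h1]
    refine Integrable.of_bound
      (Finset.measurable_prod _ fun i _ => hvm.comp (measurable_pi_apply i)).aestronglyMeasurable
      (K ^ m) (Filter.Eventually.of_forall fun x => ?_)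
    rw [Real.norm_eq_abs, Finset.abs_prod]
    calc ∏ i, |v (x i)| ≤ ∏ _i : Fin m, K := Finset.prod_le_prod (fun i _ => abs_nonneg _)
          fun i _ => (abs_of_nonneg (hv0 _)).trans_le (hK _)
      _ = K ^ m := by simp
  have hGX : (fun ω => ∏ i ∈ Finset.range m, ψ (X i ω) (D i ω)) =
      fun ω => G (X' ω, D' ω) := by
    ext ω
    exact Finset.prod_range fun i => ψ (X i ω) (D i ω)
  have hm := (hX'.prodMk hD').aemeasurable (μ := P)
  rw [hGX]
  rw [← hlaw] at hint
  refine ⟨(integrable_map_measure hG.aestronglyMeasurable hm).1 hint, ?_⟩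
  rw [← integral_map hm hG.aestronglyMeasurable, hlaw]
  rw [hlaw] at hint
  have h2 (x : Fin m → E) : ∫ d, G (x, d) ∂(P.map D') = ∏ i, u (x i) := by
    rw [hpi, integral_fintype_prod_eq_prod (f := fun (i : Fin m) d => ψ (x i) d)]
    refine Finset.prod_congr rfl fun i _ => ?_
    rw [integral_map (hD i).aemeasurable (hψx _).aestronglyMeasurable, hu]
  have h3 := hint.integral_prod_left
  rw [integral_prod _ hint]
  simp_rw [h2] at h3 ⊢
  rw [integral_map hX'.aemeasurable h3.aestronglyMeasurable]
  exact integral_congr_ae (Filter.Eventually.of_forall fun ω =>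
    (Finset.prod_range fun i => u (X i ω)).symm)

end Marking

/-! ### Joint measurability of the cluster counts. -/

section Truncation

variable {E : Type*} [MeasurableSpace E]

open scoped Classical in
/-- The kernel sending a finite measure to itself and any other measure to zero. -/
noncomputable def finiteKernel (E : Type*) [MeasurableSpace E] : Kernel (Measure E) E :=
  Kernel.piecewise (s := {m : Measure E | m Set.univ < ∞})
    (measurableSet_lt (Measure.measurable_coe MeasurableSet.univ) measurable_const)
    ⟨id, measurable_id⟩ 0

theorem finiteKernel_apply {m : Measure E} (hm : m Set.univ < ∞) : finiteKernel E m = m := by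
  simp [finiteKernel, Kernel.piecewise_apply, hm]

-- Splitting the finite measures by the integer part of their total mass writes the kernel as a
-- countable sum of finite kernels.
open scoped Classical in
instance : IsSFiniteKernel (finiteKernel E) := by
  have hs (k : ℕ) : MeasurableSet {m : Measure E | ⌊(m Set.univ).toReal⌋₊ = k ∧ m Set.univ < ∞} :=
    ((Nat.measurable_floor.comp (Measure.measurable_coe MeasurableSet.univ).ennreal_toReal)
      (measurableSet_singleton k)).inter
      (measurableSet_lt (Measure.measurable_coe MeasurableSet.univ) measurable_const)
  let κ : ℕ → Kernel (Measure E) E := fun k => Kernel.piecewise (hs k) ⟨id, measurable_id⟩ 0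
  have hκ (k : ℕ) : IsFiniteKernel (κ k) := by
    refine ⟨⟨ENNReal.ofReal (k + 1), ENNReal.ofReal_lt_top, fun m => ?_⟩⟩
    simp only [κ, Kernel.piecewise_apply, Set.mem_ofPred_eq]
    split_ifs with h
    · change m Set.univ ≤ _
      rw [← ENNReal.ofReal_toReal h.2.ne]
      refine ENNReal.ofReal_le_ofReal ?_
      rw [← h.1]
      exact (Nat.lt_floor_add_one _).le
    · simp
  have : finiteKernel E = Kernel.sum κ := by
    ext m s hms
    rw [Kernel.sum_apply' _ _ hms]
    by_cases hm : m Set.univ < ∞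
    · rw [tsum_eq_single ⌊(m Set.univ).toReal⌋₊]
      · simp [finiteKernel, κ, Kernel.piecewise_apply, hm]
      · intro k hk
        simp [κ, Kernel.piecewise_apply, hk.symm]
    · simp [finiteKernel, κ, Kernel.piecewise_apply, hm]
  rw [this]
  infer_instance

/-- The number of points of the cluster `d`, translated by `x`, in `B`; clusters with infinitely
many points are discarded. -/
noncomputable def clusterCount [AddGroup E] (B : Set E) (x : E) (d : Measure E) : ℕ :=
  pointCount (finiteKernel E d) {y | x + y ∈ B}

/-- The count is a section measure under an s-finite kernel, hence jointly measurable in the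
translation and the cluster. This is the purpose of the truncation, and Fubini over points and marks
relies on it. -/
theorem measurable_clusterCount [AddGroup E] [MeasurableAdd₂ E] {B : Set E}
    (hB : MeasurableSet B) : Measurable (Function.uncurry (clusterCount B)) := by
  have h1 : MeasurableSet {p : (E × Measure E) × E | p.1.1 + p.2 ∈ B} :=
    (measurable_fst.fst.add measurable_snd) hB
  have h2 := Kernel.measurable_kernel_prodMk_left
    (κ := (finiteKernel E).comap (Prod.snd : E × Measure E → Measure E) measurable_snd) h1
  exact Nat.measurable_floor.comp h2.ennreal_toReal

end Truncation

/-! ### Intersection volumes and polar coordinates. -/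

section Geometry

variable {n : ℕ} [NeZero n] {r rd : ℝ}

theorem interVolume_eq_zero {x : ℝ} (hx : r + rd < |x|) : interVolume n r rd x = 0 := by
  rw [interVolume]
  convert measureReal_empty
  refine Set.disjoint_iff_inter_eq_empty.1 (closedBall_disjoint_closedBall ?_)
  simpa [dist_zero_left] using hx

theorem interVolume_nonneg (x : ℝ) : 0 ≤ interVolume n r rd x := measureReal_nonneg

theorem interVolume_le (x : ℝ) : interVolume n r rd x ≤
    (volume : Measure (EuclideanSpace ℝ (Fin n))).real (closedBall 0 r) :=
  measureReal_mono Set.inter_subset_left measure_closedBall_lt_top.ne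

theorem measurable_interVolume : Measurable (interVolume n r rd) := by
  have h1 : MeasurableSet {p : ℝ × EuclideanSpace ℝ (Fin n) |
      p.2 ∈ closedBall 0 r ∧ dist p.2 (EuclideanSpace.single (0 : Fin n) p.1) ≤ rd} := by
    have hc : Continuous fun x : ℝ => EuclideanSpace.single (0 : Fin n) x :=
      by
      refine (PiLp.continuous_toLp 2 _).comp (continuous_pi fun i => ?_)
      simp only [Pi.single_apply]
      split_ifs <;> fun_prop
    refine (measurable_snd measurableSet_closedBall).inter
      (s₂ := {p : ℝ × EuclideanSpace ℝ (Fin n) | dist p.2 (EuclideanSpace.single 0 p.1) ≤ rd})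
      (measurableSet_le ?_ measurable_const)
    exact (Continuous.dist continuous_snd (hc.comp continuous_fst)).measurable
  exact (measurable_measure_prodMk_left h1).ennreal_toReal

theorem volume_real_translate (x : EuclideanSpace ℝ (Fin n)) :
    (volume.restrict (closedBall 0 rd)).real {y | x + y ∈ closedBall 0 r} =
      interVolume n r rd ‖x‖ := by
  have hms : MeasurableSet {y | x + y ∈ closedBall 0 r} :=
    (measurable_const_add x) measurableSet_closedBall
  rw [← interVolume_norm, measureReal_def, measureReal_def, Measure.restrict_apply hms,
    ← measure_preimage_add volume x (closedBall 0 r ∩ closedBall x rd)]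
  congr 2
  ext y
  simp only [Set.mem_inter_iff, Set.mem_ofPred_eq, Set.mem_preimage, mem_closedBall,
    dist_zero_right, dist_self_add_left]

theorem volume_real_closedBall {R : ℝ} (hR : 0 ≤ R) :
    (volume : Measure (EuclideanSpace ℝ (Fin n))).real (closedBall 0 R) =
      unitBallVolume n * R ^ n := by
  have hpos : 0 ≤ unitBallVolume n :=
    div_nonneg (by positivity) (Real.Gamma_pos_of_pos (by positivity)).le
  have : √Real.pi ^ n = Real.pi ^ ((n : ℝ) / 2) := by
    rw [Real.sqrt_eq_rpow, ← Real.rpow_natCast, ← Real.rpow_mul Real.pi_pos.le]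
    congr 1
    ring
  rw [measureReal_def, EuclideanSpace.volume_closedBall, ENNReal.toReal_mul, ENNReal.toReal_pow,
    ENNReal.toReal_ofReal hR, Fintype.card_fin, this, mul_comm]
  exact congrArg (· * R ^ n) (ENNReal.toReal_ofReal hpos)

theorem integral_exp_sub_one_eq_exponent (lamP lamD s : ℝ) (hlamP : 0 ≤ lamP) (hlamD : 0 ≤ lamD)
    (hR : 0 ≤ r + rd) :
    ∫ x, (Real.exp ((s - 1) * (lamD * interVolume n r rd ‖x‖)) - 1)
        ∂(ENNReal.ofReal lamP • (volume : Measure (EuclideanSpace ℝ (Fin n)))) =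
      exponent n lamP lamD rd r s := by
  set V := (volume : Measure (EuclideanSpace ℝ (Fin n))).real (closedBall 0 r)
  let u : ℝ → ℝ := fun x => Real.exp (lamD * interVolume n r rd x * (s - 1))
  have hum : Measurable u := by
    have := measurable_interVolume (n := n) (r := r) (rd := rd)
    fun_prop
  have hub (x : ℝ) : ‖u x‖ ≤ Real.exp (lamD * V * |s - 1|) := by
    rw [Real.norm_eq_abs, Real.abs_exp]
    refine Real.exp_le_exp.2 ?_
    have h0 := interVolume_nonneg (n := n) (r := r) (rd := rd) x
    calc lamD * interVolume n r rd x * (s - 1) ≤ lamD * interVolume n r rd x * |s - 1| := by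
          gcongr
          exact le_abs_self _
      _ ≤ _ := by
          gcongr
          exact interVolume_le x
  have hW : MeasurableSet (closedBall (0 : EuclideanSpace ℝ (Fin n)) (r + rd)) :=
    measurableSet_closedBall
  have hu : Integrable (fun x : EuclideanSpace ℝ (Fin n) => u ‖x‖)
      (volume.restrict (closedBall 0 (r + rd))) := by
    have : IsFiniteMeasure (volume.restrict (closedBall (0 : EuclideanSpace ℝ (Fin n)) (r + rd))) :=
      isFiniteMeasure_restrict.2 measure_closedBall_lt_top.ne
    exact Integrable.of_bound (hum.comp measurable_norm).aestronglyMeasurable _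
      (Filter.Eventually.of_forall fun x => hub _)
  -- Off the ball of radius `r + rd` the intersection volume is 0, so u = 1 and the integrand
  -- vanishes; on the ball both terms are integrable separately.
  have h1 : ∫ x : EuclideanSpace ℝ (Fin n), (u ‖x‖ - 1) =
      (∫ x in closedBall (0 : EuclideanSpace ℝ (Fin n)) (r + rd), u ‖x‖) -
        unitBallVolume n * (r + rd) ^ n := by
    rw [← volume_real_closedBall hR, ← setIntegral_eq_integral_of_forall_compl_eq_zero
      (s := closedBall (0 : EuclideanSpace ℝ (Fin n)) (r + rd)), integral_sub hu]
    · simp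
    · exact integrableOn_const measure_closedBall_lt_top.ne
    · intro x hx
      rw [mem_closedBall, dist_zero_right, not_le] at hx
      simp [u, interVolume_eq_zero (n := n) (r := r) (rd := rd) (x := ‖x‖) (by simpa using hx)]
  have h2 : ∫ x in closedBall (0 : EuclideanSpace ℝ (Fin n)) (r + rd), u ‖x‖ =
      unitBallVolume n * ∫ x in (0 : ℝ)..(r + rd), (n : ℝ) * u x * x ^ (n - 1) := by
    -- Polar coordinates for a radial function on the whole space; the indicator cuts the radius at
    -- `r + rd`.
    have h3 := integral_fun_norm_addHaar (volume : Measure (EuclideanSpace ℝ (Fin n)))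
      ((Set.Iic (r + rd)).indicator u)
    rw [← integral_indicator hW]
    have h4 : (fun x : EuclideanSpace ℝ (Fin n) => (Set.Iic (r + rd)).indicator u ‖x‖) =
        (closedBall 0 (r + rd)).indicator fun x => u ‖x‖ := by
      ext x
      by_cases hx : ‖x‖ ≤ r + rd
      · rw [Set.indicator_of_mem (Set.mem_Iic.2 hx),
          Set.indicator_of_mem (mem_closedBall_zero_iff.2 hx)]
      · rw [Set.indicator_of_notMem (fun h => hx (Set.mem_Iic.1 h)),
          Set.indicator_of_notMem (fun h => hx (mem_closedBall_zero_iff.1 h))]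
    have h5 : (volume : Measure (EuclideanSpace ℝ (Fin n))).real (ball 0 1) =
        unitBallVolume n := by
      rw [measureReal_def, ← Measure.addHaar_closedBall_eq_addHaar_ball, ← measureReal_def,
        volume_real_closedBall zero_le_one, one_pow, mul_one]
    have h6 : (fun y : ℝ => y ^ (n - 1) • (Set.Iic (r + rd)).indicator u y) =
        (Set.Iic (r + rd)).indicator fun y => y ^ (n - 1) * u y := by
      ext y
      simp [Set.indicator_apply]
    rw [← h4, h3, finrank_euclideanSpace_fin, h5, h6, setIntegral_indicator measurableSet_Iic,
      Set.Ioi_inter_Iic, ← intervalIntegral.integral_of_le hR, nsmul_eq_mul, smul_eq_mul,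
      mul_left_comm, ← intervalIntegral.integral_const_mul]
    congr 2
    ext y
    ring
  have h7 (x : EuclideanSpace ℝ (Fin n)) :
      Real.exp ((s - 1) * (lamD * interVolume n r rd ‖x‖)) = u ‖x‖ := by
    simp only [u]
    ring_nf
  simp_rw [h7]
  rw [integral_smul_measure, ENNReal.toReal_ofReal hlamP, h1, h2, exponent, smul_eq_mul]
  ring

end Geometry
-- Contribution of a single cluster.
section Cluster

variable {Ω : Type*} [MeasurableSpace Ω] {P : Measure Ω} {n : ℕ} {lamD r rd : ℝ}

theorem measurableSet_translate (x : EuclideanSpace ℝ (Fin n)) :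
    MeasurableSet {y | x + y ∈ closedBall (0 : EuclideanSpace ℝ (Fin n)) r} :=
  (measurable_const_add x) measurableSet_closedBall

theorem daughterIntensity_lt_top (B : Set (EuclideanSpace ℝ (Fin n))) :
    (ENNReal.ofReal lamD • volume.restrict (closedBall 0 rd) :
      Measure (EuclideanSpace ℝ (Fin n))) B < ∞ := by
  rw [Measure.smul_apply, smul_eq_mul]
  exact ENNReal.mul_lt_top ENNReal.ofReal_lt_top
    ((measure_mono (Set.subset_univ B)).trans_lt (by simp [measure_closedBall_lt_top]))

variable {D : Ω → Measure (EuclideanSpace ℝ (Fin n))}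

/-- The exceptional null set must not depend on x, since x is later a random parent. Integrality
therefore comes from local finiteness of the configuration, not from the Poisson law of each
translate; finite total mass makes the truncation invisible. -/
theorem ae_clusterCount_eq (hD : IsPoissonProcess P
      (ENNReal.ofReal lamD • volume.restrict (closedBall 0 rd)) D) :
    ∀ᵐ ω ∂P, ∀ x, D ω {y | x + y ∈ closedBall 0 r} = clusterCount (closedBall 0 r) x (D ω) ∧
      clusterCount (closedBall 0 r) x (D ω) =
        pointCount (D ω) {y | x + y ∈ closedBall 0 r} := by
  filter_upwards [hD.isPointConfiguration,
    hD.ae_exists_nat MeasurableSet.univ (daughterIntensity_lt_top _)] with ω h1 ⟨k, hk⟩ x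
  have hfin : D ω Set.univ < ∞ := by rw [hk]; exact ENNReal.natCast_lt_top k
  have heq : clusterCount (closedBall 0 r) x (D ω) =
      pointCount (D ω) {y | x + y ∈ closedBall 0 r} := by
    rw [clusterCount, finiteKernel_apply hfin]
  refine ⟨?_, heq⟩
  have hb : Bornology.IsBounded {y | x + y ∈ closedBall (0 : EuclideanSpace ℝ (Fin n)) r} := by
    refine (isBounded_closedBall (x := -x) (r := r)).subset fun y hy => ?_
    simpa [dist_eq_norm, add_comm] using hy
  obtain ⟨j, hj⟩ := h1 _ (measurableSet_translate x) hb
  rw [heq, pointCount, hj]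
  simp

/-- The count outside the ball of radius `rd` is Poisson with mean 0, so almost surely the cluster
charges only that ball; the triangle inequality does the rest, for all x at once. -/
theorem ae_clusterCount_eq_zero (hD : IsPoissonProcess P
      (ENNReal.ofReal lamD • volume.restrict (closedBall 0 rd)) D) :
    ∀ᵐ ω ∂P, ∀ x ∉ closedBall 0 (r + rd), clusterCount (closedBall 0 r) x (D ω) = 0 := by
  have hm : MeasurableSet (closedBall (0 : EuclideanSpace ℝ (Fin n)) rd)ᶜ :=
    measurableSet_closedBall.compl
  have h0 : (ENNReal.ofReal lamD • volume.restrict (closedBall 0 rd) :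
      Measure (EuclideanSpace ℝ (Fin n))) (closedBall 0 rd)ᶜ = 0 := by
    simp [Measure.restrict_apply hm]
  have h1 : ∀ᵐ ω ∂P, D ω (closedBall 0 rd)ᶜ = 0 := by
    have hl := hD.hasLaw _ hm (daughterIntensity_lt_top _)
    have : ∀ᵐ x ∂(P.map fun ω => D ω (closedBall 0 rd)ᶜ), x = (0 : ℝ≥0∞) := by
      have hk : poissonMeasure 0 {0}ᶜ = 0 := by
        rw [prob_compl_eq_zero_iff (measurableSet_singleton 0), poissonMeasure_singleton]
        simp
      rw [hl.map_eq, h0, ENNReal.toNNReal_zero,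
        ae_map_iff (p := fun x => x = 0) Measurable.of_discrete.aemeasurable
          (measurableSet_singleton 0)]
      rw [ae_iff]
      convert hk using 2
      ext k
      rw [Set.mem_ofPred_eq, Nat.cast_eq_zero, Set.mem_compl_singleton_iff]
    exact ae_of_ae_map hl.aemeasurable this
  filter_upwards [ae_clusterCount_eq hD (r := r), h1] with ω h2 h3 x hx
  have h4 : D ω {y | x + y ∈ closedBall 0 r} = 0 := by
    refine measure_mono_null (fun y hy => ?_) h3
    simp only [Set.mem_compl_iff, mem_closedBall, dist_zero_right, Set.mem_ofPred_eq,
      not_le] at hx hy ⊢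
    have := norm_sub_le (x + y) y
    rw [add_sub_cancel_right] at this
    linarith
  rw [(h2 x).2, pointCount, h4]
  simp

theorem integral_pow_clusterCount [NeZero n] (hlamD : 0 ≤ lamD) (hD : IsPoissonProcess P
      (ENNReal.ofReal lamD • volume.restrict (closedBall 0 rd)) D)
    (x : EuclideanSpace ℝ (Fin n)) (a : ℝ) :
    Integrable (fun ω => a ^ clusterCount (closedBall 0 r) x (D ω)) P ∧
      ∫ ω, a ^ clusterCount (closedBall 0 r) x (D ω) ∂P =
        Real.exp ((a - 1) * (lamD * interVolume n r rd ‖x‖)) := by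
  have h1 : (fun ω => a ^ clusterCount (closedBall 0 r) x (D ω)) =ᵐ[P]
      fun ω => a ^ pointCount (D ω) {y | x + y ∈ closedBall 0 r} := by
    filter_upwards [ae_clusterCount_eq hD (r := r)] with ω h
    rw [(h x).2]
  obtain ⟨h2, h3⟩ := hD.integral_pow_count (measurableSet_translate (r := r) x)
    (daughterIntensity_lt_top _) a
  refine ⟨h2.congr h1.symm, ?_⟩
  rw [integral_congr_ae h1, h3, measureReal_ennreal_smul_apply, volume_real_translate,
    ENNReal.toReal_ofReal hlamD, mul_comm]

end Cluster

/-! ### From finitely many clusters to the whole process. -/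

/-- If the configuration of the points `X i` has finitely many points in `W`, then `X i` lies
outside `W` for all large `i`. -/
theorem exists_forall_ge_notMem_of_sum_dirac_lt_top {E : Type*} [MeasurableSpace E] {X : ℕ → E} {W : Set E}
    (hW : MeasurableSet W) (h : (Measure.sum fun i => Measure.dirac (X i)) W < ∞) :
    ∃ m₀, ∀ i ≥ m₀, X i ∉ W := by
  rw [Measure.sum_apply _ hW] at h
  have hf : {i | X i ∈ W}.Finite := by
    -- Every point in `W` contributes 1 to a series with finite sum.
    have h1 := ENNReal.finite_const_le_of_tsum_ne_top h.ne one_ne_zero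
    refine h1.subset fun i hi => ?_
    simp [Measure.dirac_apply' _ hW, Set.indicator_of_mem (show X i ∈ W from hi)]
  obtain ⟨m, hm⟩ := hf.bddAbove
  exact ⟨m + 1, fun i hi hiW => absurd (hm hiW) (by omega)⟩

/-- Almost surely, only finitely many clusters meet the ball, so that the number of points in it
and the integral over the parent points are finite sums. -/
theorem ae_eventually_sum_eq {Ω : Type*} [MeasurableSpace Ω] {P : Measure Ω}
    {n : ℕ} {lamD r rd : ℝ} {Λ : Measure (EuclideanSpace ℝ (Fin n))}
    {X : ℕ → Ω → EuclideanSpace ℝ (Fin n)} {D : ℕ → Ω → Measure (EuclideanSpace ℝ (Fin n))}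
    (hPX : IsPoissonProcess P Λ fun ω => Measure.sum fun i => Measure.dirac (X i ω))
    (hΛ : Λ (closedBall 0 (r + rd)) < ∞)
    (hPD : ∀ i, IsPoissonProcess P
      (ENNReal.ofReal lamD • volume.restrict (closedBall 0 rd)) (D i))
    {Φ : Ω → Measure (EuclideanSpace ℝ (Fin n))}
    (hΦ : ∀ᵐ ω ∂P, Φ ω = clusterUnion (fun i => X i ω) (fun i => D i ω))
    {f : EuclideanSpace ℝ (Fin n) → ℝ} (hf : ∀ x ∉ closedBall 0 (r + rd), f x = 0) :
    ∀ᵐ ω ∂P, Φ ω (closedBall 0 r) = (pointCount (Φ ω) (closedBall 0 r) : ℝ≥0∞) ∧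
      ∃ m₀, ∀ m, m₀ ≤ m →
        ∑ i ∈ Finset.range m, clusterCount (closedBall 0 r) (X i ω) (D i ω) =
            pointCount (Φ ω) (closedBall 0 r) ∧
          ∑ i ∈ Finset.range m, f (X i ω) =
            ∫ x, f x ∂(Measure.sum fun i => Measure.dirac (X i ω)) := by
  have hfin := hPX.ae_exists_nat measurableSet_closedBall hΛ
  have h1 := ae_all_iff.2 fun i => ae_clusterCount_eq (r := r) (hPD i)
  have h2 := ae_all_iff.2 fun i => ae_clusterCount_eq_zero (r := r) (hPD i)
  filter_upwards [hΦ, hfin, h1, h2] with ω hω ⟨k, hk⟩ h1 h2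
  obtain ⟨m₀, hm₀⟩ := exists_forall_ge_notMem_of_sum_dirac_lt_top (X := fun i => X i ω)
    (measurableSet_closedBall (x := 0) (ε := r + rd)) (by rw [hk]; exact ENNReal.natCast_lt_top k)
  have hsum (m : ℕ) (hm : m₀ ≤ m) :
      Φ ω (closedBall 0 r) = ((∑ i ∈ Finset.range m, clusterCount (closedBall 0 r) (X i ω) (D i ω) : ℕ) : ℝ≥0∞) := by
    rw [hω, clusterUnion, Measure.sum_apply _ measurableSet_closedBall, Nat.cast_sum,
      tsum_eq_sum (s := Finset.range m)]
    · refine Finset.sum_congr rfl fun i _ => ?_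
      rw [Measure.map_apply (measurable_const_add _) measurableSet_closedBall]
      exact (h1 i (X i ω)).1
    · intro i hi
      rw [Measure.map_apply (measurable_const_add _) measurableSet_closedBall]
      refine (h1 i (X i ω)).1.trans ?_
      rw [h2 i _ (hm₀ i (hm.trans (by simpa using hi))), Nat.cast_zero]
  have hN (m : ℕ) (hm : m₀ ≤ m) :
        ∑ i ∈ Finset.range m, clusterCount (closedBall 0 r) (X i ω) (D i ω) =
          pointCount (Φ ω) (closedBall 0 r) := by
    rw [pointCount, hsum m hm, ENNReal.toReal_natCast, Nat.floor_natCast]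
  refine ⟨by rw [hsum m₀ le_rfl, hN m₀ le_rfl], m₀, fun m hm => ⟨hN m hm, ?_⟩⟩
  have h3 : ∫ x, f x ∂(Measure.sum fun i => Measure.dirac (X i ω)) = ∑' i, f (X i ω) := by
    have h3 := integral_sum_dirac (x := fun i => X i ω) (c := fun _ : ℕ => 1) (f := f) (by simp)
    simpa using h3
  rw [h3, tsum_eq_sum (s := Finset.range m)]
  intro i hi
  exact hf _ (hm₀ i (hm.trans (by simpa using hi)))

/-- The generating function of finitely many clusters, in terms of their parent points. -/
theorem integral_pow_sum_clusterCount {Ω : Type*} [MeasurableSpace Ω] {P : Measure Ω}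
    [IsProbabilityMeasure P] {n : ℕ} [NeZero n] {lamD r rd : ℝ} (hlamD : 0 ≤ lamD)
    {X : ℕ → Ω → EuclideanSpace ℝ (Fin n)} {D : ℕ → Ω → Measure (EuclideanSpace ℝ (Fin n))}
    (hX : ∀ i, Measurable (X i))
    (hPD : ∀ i, IsPoissonProcess P
      (ENNReal.ofReal lamD • volume.restrict (closedBall 0 rd)) (D i))
    (hDi : iIndepFun D P) (hXD : IndepFun (fun ω i => X i ω) (fun ω i => D i ω) P)
    (a : ℝ) (m : ℕ) :
    Integrable (fun ω => a ^ ∑ i ∈ Finset.range m,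
        clusterCount (closedBall 0 r) (X i ω) (D i ω)) P ∧
      ∫ ω, a ^ ∑ i ∈ Finset.range m, clusterCount (closedBall 0 r) (X i ω) (D i ω) ∂P =
        ∫ ω, Real.exp ((a - 1) *
          ∑ i ∈ Finset.range m, lamD * interVolume n r rd ‖X i ω‖) ∂P := by
  let C := lamD * (volume : Measure (EuclideanSpace ℝ (Fin n))).real (closedBall 0 r)
  let f : EuclideanSpace ℝ (Fin n) → ℝ := fun x => lamD * interVolume n r rd ‖x‖
  have hf0 (x) : 0 ≤ f x := mul_nonneg hlamD (interVolume_nonneg _)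
  have hfC (x) : f x ≤ C := mul_le_mul_of_nonneg_left (interVolume_le _) hlamD
  have hfm : Measurable f := (measurable_interVolume.comp measurable_norm).const_mul lamD
  have hpow : Measurable fun k : ℕ => a ^ k := Measurable.of_discrete
  have h := integral_prod_marks hX (fun i => (hPD i).measurable) hDi hXD
    (ψ := fun x d => a ^ clusterCount (closedBall 0 r) x d)
    (hpow.comp (measurable_clusterCount measurableSet_closedBall))
    (fun x i => (integral_pow_clusterCount hlamD (hPD i) x a).1)
    (u := fun x => Real.exp ((a - 1) * f x)) (v := fun x => Real.exp ((|a| - 1) * f x))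
    (fun x i => (integral_pow_clusterCount hlamD (hPD i) x a).2)
    (fun x i => by
      simp_rw [abs_pow]
      exact (integral_pow_clusterCount hlamD (hPD i) x |a|).2)
    -- The outer absolute value is needed because |a| - 1 may be negative.
    (by fun_prop) (K := Real.exp (|(|a| - 1)| * C))
    (fun x => Real.exp_le_exp.2 (mul_le_mul (le_abs_self _) (hfC x) (hf0 x) (abs_nonneg _))) m
  simp only [Finset.prod_pow_eq_pow_sum, ← Real.exp_sum, ← Finset.mul_sum] at h
  exact h

/-- If the generating functions of `M m` are those of Poisson variables with random means `T m`,
and `M m`, `T m` eventually attain their upper bounds `N`, `S`, then the same holds of `N`, `S`. -/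
theorem integral_pow_of_eventually_eq {Ω : Type*} [MeasurableSpace Ω] {P : Measure Ω}
    {M : ℕ → Ω → ℕ} {T : ℕ → Ω → ℝ} {N : Ω → ℕ} {S : Ω → ℝ}
    (hfin : ∀ (a : ℝ) (m : ℕ), Integrable (fun ω => a ^ M m ω) P ∧
      ∫ ω, a ^ M m ω ∂P = ∫ ω, Real.exp ((a - 1) * T m ω) ∂P)
    (hT : ∀ m, Measurable (T m)) (hS : ∀ t, Integrable (fun ω => Real.exp (t * S ω)) P)
    (hT0 : ∀ m ω, 0 ≤ T m ω)
    (hmono : ∀ᵐ ω ∂P, ∀ m, M m ω ≤ N ω ∧ T m ω ≤ S ω)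
    (key : ∀ᵐ ω ∂P, ∃ m₀, ∀ m, m₀ ≤ m → M m ω = N ω ∧ T m ω = S ω) (s : ℝ) :
    Integrable (fun ω => s ^ N ω) P ∧
      ∫ ω, s ^ N ω ∂P = ∫ ω, Real.exp ((s - 1) * S ω) ∂P := by
  have hlimN (a : ℝ) : ∀ᵐ ω ∂P, Filter.Tendsto (fun m => a ^ M m ω)
      Filter.atTop (nhds (a ^ N ω)) := by
    filter_upwards [key] with ω ⟨m₀, h⟩
    refine tendsto_const_nhds.congr' ?_
    filter_upwards [Filter.eventually_ge_atTop m₀] with m hm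
    rw [(h m hm).1]
  have hlimS (t : ℝ) : ∀ᵐ ω ∂P, Filter.Tendsto
      (fun m => Real.exp (t * T m ω))
      Filter.atTop (nhds (Real.exp (t * S ω))) := by
    filter_upwards [key] with ω ⟨m₀, h⟩
    refine tendsto_const_nhds.congr' ?_
    filter_upwards [Filter.eventually_ge_atTop m₀] with m hm
    rw [(h m hm).2]
  have hNm (a : ℝ) : AEStronglyMeasurable (fun ω => a ^ N ω) P :=
    aestronglyMeasurable_of_tendsto_ae _ (fun m => (hfin a m).1.aestronglyMeasurable) (hlimN a)
  -- Fatou's lemma: for a ≥ 1 the expectations of a^(M m) are bounded by that of exp((a - 1) S),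
  -- because T m ≤ S and a - 1 ≥ 0.
  have hint (a : ℝ) (ha : 1 ≤ a) : Integrable (fun ω => a ^ N ω) P := by
    have ha0 : 0 ≤ a := zero_le_one.trans ha
    refine ⟨hNm a, ?_⟩
    rw [hasFiniteIntegral_iff_ofReal (Filter.Eventually.of_forall fun ω => by positivity)]
    have h1 : ∫⁻ ω, ENNReal.ofReal (a ^ N ω) ∂P ≤ Filter.liminf
        (fun m => ∫⁻ ω, ENNReal.ofReal (a ^ M m ω) ∂P) Filter.atTop := by
      refine le_trans (lintegral_mono_ae ?_) (lintegral_liminf_le'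
        fun m => (hfin a m).1.aestronglyMeasurable.aemeasurable.ennreal_ofReal)
      filter_upwards [hlimN a] with ω h
      exact ((ENNReal.continuous_ofReal.tendsto _).comp h).liminf_eq.ge
    refine h1.trans_lt (lt_of_le_of_lt (Filter.liminf_le_of_frequently_le'
      (Filter.Frequently.of_forall fun m => ?_))
      (ENNReal.ofReal_lt_top (r := ∫ ω, Real.exp ((a - 1) * S ω) ∂P)))
    rw [← ofReal_integral_eq_lintegral_ofReal (hfin a m).1
      (Filter.Eventually.of_forall fun ω => by positivity), (hfin a m).2]
    refine ENNReal.ofReal_le_ofReal (integral_mono_of_nonneg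
      (Filter.Eventually.of_forall fun ω => (Real.exp_pos _).le) (hS (a - 1)) ?_)
    filter_upwards [hmono] with ω h
    exact Real.exp_le_exp.2 (mul_le_mul_of_nonneg_left (h m).2 (sub_nonneg.2 ha))
  -- Replacing |s| by a base at least 1 makes the power monotone in the exponent, so M m ≤ N gives a
  -- bound even when |s| < 1.
  have hmax : 1 ≤ max 1 |s| := le_max_left _ _
  have hdomN (m : ℕ) : ∀ᵐ ω ∂P, ‖s ^ M m ω‖ ≤ max 1 |s| ^ N ω := by
    filter_upwards [hmono] with ω h
    rw [norm_pow, Real.norm_eq_abs]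
    exact (pow_le_pow_left₀ (abs_nonneg s) (le_max_right _ _) _).trans
      (pow_le_pow_right₀ hmax (h m).1)
  have hdomS (m : ℕ) : ∀ᵐ ω ∂P, ‖Real.exp ((s - 1) * T m ω)‖ ≤
      Real.exp (|s - 1| * S ω) := by
    filter_upwards [hmono] with ω h
    rw [Real.norm_eq_abs, Real.abs_exp]
    exact Real.exp_le_exp.2 (mul_le_mul (le_abs_self _) (h m).2
      (hT0 m ω) (abs_nonneg _))
  have hA := tendsto_integral_of_dominated_convergence _
    (fun m => (hfin s m).1.aestronglyMeasurable) (hint _ hmax) hdomN (hlimN s)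
  have hB := tendsto_integral_of_dominated_convergence _
    (fun m => (Real.measurable_exp.comp ((hT m).const_mul _)).aestronglyMeasurable) (hS |s - 1|) hdomS (hlimS (s - 1))
  refine ⟨(hint _ hmax).mono' (hNm s) (Filter.Eventually.of_forall fun ω => ?_), ?_⟩
  · rw [norm_pow, Real.norm_eq_abs]
    exact pow_le_pow_left₀ (abs_nonneg s) (le_max_right _ _) _
  · simp_rw [(hfin s _).2] at hA
    exact tendsto_nhds_unique hA hB

end MaternCluster

/-! ### The generating function of the process. -/

open MaternCluster in
theorem theorem1 {Ω : Type*} [MeasurableSpace Ω] (P : Measure Ω) [IsProbabilityMeasure P]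
    (n : ℕ) [NeZero n] (lamP lamD rd r : ℝ)
    (hlamP : 0 < lamP) (hlamD : 0 ≤ lamD) (hrd : 0 ≤ rd) (hr : 0 ≤ r)
    (Φ : Ω → Measure (EuclideanSpace ℝ (Fin n)))
    (hΦ : MaternCluster.IsMaternClusterProcess P lamP lamD rd Φ) :
    (∀ᵐ ω ∂P, Φ ω (closedBall 0 r) =
      (MaternCluster.pointCount (Φ ω) (closedBall 0 r) : ℝ≥0∞)) ∧
    ∀ s : ℝ,
      Integrable (fun ω => s ^ MaternCluster.pointCount (Φ ω) (closedBall 0 r)) P ∧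
      ∫ ω, s ^ MaternCluster.pointCount (Φ ω) (closedBall 0 r) ∂P =
        Real.exp (MaternCluster.exponent n lamP lamD rd r s) := by
  obtain ⟨X, D, hX, hPX, hPD, hDi, hXD, hΦ⟩ := hΦ
  set W := closedBall (0 : EuclideanSpace ℝ (Fin n)) (r + rd) with hWdef
  have hW : MeasurableSet W := measurableSet_closedBall
  have hΛW : (ENNReal.ofReal lamP • volume : Measure (EuclideanSpace ℝ (Fin n))) W < ∞ := by
    rw [Measure.smul_apply, smul_eq_mul]
    exact ENNReal.mul_lt_top ENNReal.ofReal_lt_top measure_closedBall_lt_top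
  let f : EuclideanSpace ℝ (Fin n) → ℝ := fun x => lamD * interVolume n r rd ‖x‖
  have hf0 (x) : 0 ≤ f x := mul_nonneg hlamD (interVolume_nonneg _)
  let C := lamD * (volume : Measure (EuclideanSpace ℝ (Fin n))).real (closedBall 0 r)
  have hfC (x) : f x ≤ C := mul_le_mul_of_nonneg_left (interVolume_le _) hlamD
  have hfW : ∀ x ∉ W, f x = 0 := by
    intro x hx
    rw [hWdef, mem_closedBall, dist_zero_right, not_le] at hx
    simp [f, interVolume_eq_zero (n := n) (r := r) (rd := rd) (x := ‖x‖) (by simpa using hx)]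
  have hfm : Measurable f := (measurable_interVolume.comp measurable_norm).const_mul lamD
  let η : Ω → Measure (EuclideanSpace ℝ (Fin n)) :=
    fun ω => Measure.sum fun i => Measure.dirac (X i ω)
  let c : ℕ → Ω → ℕ := fun i ω => clusterCount (closedBall 0 r) (X i ω) (D i ω)
  let N : Ω → ℕ := fun ω => pointCount (Φ ω) (closedBall 0 r)
  have key : ∀ᵐ ω ∂P, Φ ω (closedBall 0 r) = (N ω : ℝ≥0∞) ∧
      ∃ m₀, ∀ m, m₀ ≤ m → ∑ i ∈ Finset.range m, c i ω = N ω ∧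
        ∑ i ∈ Finset.range m, f (X i ω) = ∫ x, f x ∂(η ω) :=
    ae_eventually_sum_eq hPX hΛW hPD hΦ hfW
  refine ⟨key.mono fun ω h => h.1, ?_⟩
  -- All real t are needed: t = s - 1 gives the value, other t serve as dominating functions in the
  -- limit.
  have hS (t : ℝ) := hPX.integral_exp_integral (f := fun x => t * f x) (hfm.const_mul t)
    (C := |t| * C) (fun x => by
      rw [abs_mul, abs_of_nonneg (hf0 x)]
      exact mul_le_mul_of_nonneg_left (hfC x) (abs_nonneg t)) hW hΛW
    (fun x hx => by rw [hfW x hx, mul_zero])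
  simp_rw [integral_const_mul] at hS
  have hmono : ∀ᵐ ω ∂P, ∀ m, ∑ i ∈ Finset.range m, c i ω ≤ N ω ∧
      ∑ i ∈ Finset.range m, f (X i ω) ≤ ∫ x, f x ∂(η ω) := by
    filter_upwards [key] with ω ⟨_, m₀, h⟩ m
    -- At the index max(m₀, m) the partial sums have reached their final values; the terms are
    -- nonnegative, so the sums up to m are no larger.
    obtain ⟨h1, h2⟩ := h _ (le_max_left m₀ m)
    have hsub : Finset.range m ⊆ Finset.range (max m₀ m) :=
      Finset.range_subset_range.2 (le_max_right _ _)
    rw [← h1, ← h2]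
    exact ⟨Finset.sum_le_sum_of_subset hsub,
      Finset.sum_le_sum_of_subset_of_nonneg hsub fun _ _ _ => hf0 _⟩
  intro s
  obtain ⟨h1, h2⟩ := integral_pow_of_eventually_eq
    (integral_pow_sum_clusterCount hlamD hX hPD hDi hXD)
    (fun m => Finset.measurable_sum _ fun i _ => hfm.comp (hX i)) (fun t => (hS t).1)
    (fun m ω => Finset.sum_nonneg fun _ _ => hf0 _) hmono (key.mono fun ω h => h.2) s
  refine ⟨h1, h2.trans ?_⟩
  rw [(hS (s - 1)).2,
    integral_exp_sub_one_eq_exponent lamP lamD s hlamP.le hlamD (add_nonneg hr hrd)]
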